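/- Definitions. A dataset is a tuple $d\in X^m$ of $m$ records from a set $X$; write $d\sim d'$ if $d,d'$ have Hamming distance exactly one. A mechanism $\mathcal M$ assigns to each dataset $d$ a probability measure $\mathcal M_d$ on a measurable space. It is $(\varepsilon,\delta)$-DP if $\mathcal M_d(A)\le e^{\varepsilon}\mathcal M_{d'}(A)+\delta$ for all $d\sim d'$ and all measurable $A$. The $L_2$-sensitivity of a query $f:X^m\to\mathbb R^n$ is $\sup_{d\sim d'}\|f(d)-f(d')\|_2$, and the Gaussian mechanism with query $f$ and variance $\sigma^2>0$ is $d\mapsto\mathcal N(f(d),\sigma^2 I_n)$. A $T$-fold adaptive homogeneous composition of Gaussian mechanisms with variance $\sigma^2$ outputs $(y_1,\dots,y_T)$, where, for each $i$ and each history $(y_1,\dots,y_{i-1})$, $y_i$ is drawn (by a Markov kernel) from a Gaussian mechanism on $\mathbb R^n$ with variance $\sigma^2$ whose query may depend on $i$ and on the history and has $L_2$-sensitivity at most one. For $\alpha>1$ let $D_\alpha(P\|Q)=\frac1{\alpha-1}\log\mathbb E_Q[(dP/dQ)^\alpha]$ (and $+\infty$ if $P\not\ll Q$), and let $\gamma_{\mathcal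 M}(\alpha)=\sup_{d\sim d'}D_\alpha(\mathcal M_d\|\mathcal M_{d'})$. The moments accountant certifies that the $T$-fold composition of $\mathcal M$ is $(\varepsilon,\delta)$-DP if $\inf_{\alpha>1}\big(\gamma_{\mathcal M}(\alpha)T-\frac1{\alpha-1}\log\delta\big)\le\varepsilon$. Theorem. Fix an integer $T\ge1$ and $\varepsilon>0$. There are functions $R,R_{\mathrm{MA}}$ of $\delta$, depending only on $T$ and $\varepsilon$, with $$R(\delta)=O\!\left(\frac{\log^2(\log\delta^{-1})}{\log\delta^{-1}}\right),\qquad R_{\mathrm{MA}}(\delta)=O\!\left(\frac1{\log\delta^{-1}}\right)\qquad(\delta\to0^+),$$ such that the following hold, where $$V(\delta)=\frac{2T}{\varepsilon^2}\log\frac1\delta+\frac T\varepsilon-\frac{2T}{\varepsilon^2}\big(\log(2\log\delta^{-1})+1-\log\varepsilon\big)+R(\delta),\qquad V_{\mathrm{MA}}(\delta)=\frac{2T}{\varepsilon^2}\log\frac1\delta+\frac T\varepsilon+R_{\mathrm{MA}}(\delta).$$ (1) For every $\delta\in(0,1)$ with $\varepsilon>2\delta\log\frac1\delta$, all $m,n,X$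 and every $\sigma>0$ with $\sigma^2\ge V(\delta)$, every $T$-fold adaptive homogeneous composition of Gaussian mechanisms with variance $\sigma^2$ is $(\varepsilon,\delta)$-DP. (2) For every $\delta\in(0,1)$, all $m,n,X$, every query $f:X^m\to\mathbb R^n$ of $L_2$-sensitivity exactly one and every $\sigma>0$, the moments accountant certifies that the $T$-fold composition of the Gaussian mechanism with query $f$ and variance $\sigma^2$ is $(\varepsilon,\delta)$-DP if and only if $\sigma^2\ge V_{\mathrm{MA}}(\delta)$. (3) For all sufficiently small $\delta>0$ one has $V(\delta)<V_{\mathrm{MA}}(\delta)$. -/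

import Mathlib

open MeasureTheory ProbabilityTheory Filter Topology Asymptotics
open scoped ENNReal

universe u v

namespace GaussDP

/-- A dataset with `m` records from `X`. -/
abbrev Dataset (m : ℕ) (X : Type u) : Type u := Fin m → X

/-- Neighbouring datasets: Hamming distance exactly one. -/
def Neighbor {m : ℕ} {X : Type u} (d d' : Dataset m X) : Prop :=
  letI : DecidableEq X := Classical.decEq X
  hammingDist d d' = 1

/-- A mechanism (a measure on the output space for every dataset) is `(ε, δ)`-differentially
private: `M d A - exp ε * M d' A ≤ δ` for all measurable `A` and all neighbours `d`, `d'`. -/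
def IsDP {m : ℕ} {X : Type u} {Y : Type v} [MeasurableSpace Y]
    (M : Dataset m X → Measure Y) (ε δ : ℝ) : Prop :=
  ∀ d d' : Dataset m X, Neighbor d d' → ∀ A : Set Y, MeasurableSet A →
    M d A ≤ ENNReal.ofReal (Real.exp ε) * M d' A + ENNReal.ofReal δ

/-- The Rényi divergence `D_α(P‖Q) = (α - 1)⁻¹ log E_Q[(dP/dQ)^α]` of order `α > 1`, which is `⊤`
when `P` is not absolutely continuous with respect to `Q`. -/
noncomputable def renyiDiv {Y : Type v} [MeasurableSpace Y] (α : ℝ) (P Q : Measure Y) : EReal :=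
  letI := Classical.propDecidable (P ≪ Q)
  if P ≪ Q then (((α - 1)⁻¹ : ℝ) : EReal) * ENNReal.log (∫⁻ y, (P.rnDeriv Q y) ^ α ∂Q) else ⊤

/-- The Rényi privacy parameter `γ(α)`, the supremum of `D_α(M_d‖M_d')` over neighbours. -/
noncomputable def rdpParam {m : ℕ} {X : Type u} {Y : Type v} [MeasurableSpace Y]
    (M : Dataset m X → Measure Y) (α : ℝ) : EReal :=
  ⨆ (d : Dataset m X) (d' : Dataset m X) (_ : Neighbor d d'), renyiDiv α (M d) (M d')

/-- The privacy parameter `inf_{α > 1} (γ(α) T - (α - 1)⁻¹ log δ)` that the moments accountant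
assigns, at level `δ`, to the `T`-fold composition of the mechanism `M`. -/
noncomputable def maEpsilon {m : ℕ} {X : Type u} {Y : Type v} [MeasurableSpace Y]
    (M : Dataset m X → Measure Y) (T : ℕ) (δ : ℝ) : EReal :=
  ⨅ (α : ℝ) (_ : 1 < α),
    rdpParam M α * (((T : ℝ)) : EReal) - (((α - 1)⁻¹ * Real.log δ : ℝ) : EReal)

/-- The `L₂`-sensitivity `sup_{d ∼ d'} ‖f d - f d'‖₂` of a query. -/
noncomputable def l2Sensitivity {m n : ℕ} {X : Type u}
    (f : Dataset m X → EuclideanSpace ℝ (Fin n)) : ℝ≥0∞ :=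
  ⨆ (d : Dataset m X) (d' : Dataset m X) (_ : Neighbor d d'), edist (f d) (f d')

/-- The Gaussian mechanism with query `f` and variance `σ²`: `d ↦ N(f d, σ² Iₙ)`. -/
noncomputable def gaussianMechanism {m n : ℕ} {X : Type u}
    (f : Dataset m X → EuclideanSpace ℝ (Fin n)) (σ : ℝ) (d : Dataset m X) :
    Measure (EuclideanSpace ℝ (Fin n)) :=
  multivariateGaussian (f d) (σ ^ 2 • (1 : Matrix (Fin n) (Fin n) ℝ))

/-- The law of the transcript `(y₀, …, y_{T-1})` of `T` rounds in which the output of round `i`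
is drawn from `κ i (y₀, …, y_{i-1})`. -/
noncomputable def transcript {Y : Type v} [MeasurableSpace Y]
    (κ : ∀ i : ℕ, Kernel (Fin i → Y) Y) : ∀ T : ℕ, Measure (Fin T → Y)
  | 0 => Measure.dirac Fin.elim0
  | T + 1 => (transcript κ T ⊗ₘ κ T).map
      (fun p => (Fin.snoc p.1 p.2 : Fin (T + 1) → Y))

/-- `κ` describes `T` adaptively chosen rounds of a Gaussian mechanism on `ℝⁿ` with variance `σ²`:
for every round `i < T` and every history `h` of outputs of the earlier rounds, the mechanism
`d ↦ κ i d h` of round `i` is a Gaussian mechanism with variance `σ²` whose query (which may depend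
on `i` and on `h`) has `L₂`-sensitivity at most one. -/
def IsAdaptiveGaussian {m n : ℕ} {X : Type u} (T : ℕ) (σ : ℝ)
    (κ : ∀ i : ℕ, Dataset m X →
      Kernel (Fin i → EuclideanSpace ℝ (Fin n)) (EuclideanSpace ℝ (Fin n))) : Prop :=
  ∀ i < T, ∀ h : Fin i → EuclideanSpace ℝ (Fin n),
    ∃ f : Dataset m X → EuclideanSpace ℝ (Fin n), l2Sensitivity f ≤ 1 ∧
      ∀ d, κ i d h = gaussianMechanism f σ d

/-- The explicit part `(2T/ε²) log(1/δ) + T/ε` of the variance that the moments accountant needs. -/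
noncomputable def maVariance (T : ℕ) (ε δ : ℝ) : ℝ :=
  2 * T / ε ^ 2 * Real.log (1 / δ) + T / ε

/-- The explicit part of the improved variance. -/
noncomputable def improvedVariance (T : ℕ) (ε δ : ℝ) : ℝ :=
  2 * T / ε ^ 2 * Real.log (1 / δ) + T / ε
    - 2 * T / ε ^ 2 * (Real.log (2 * Real.log δ⁻¹) + 1 - Real.log ε)

end GaussDP

/-! For Gaussians at distance `‖a - b‖`, the log-likelihood ratio under the second is `N(-v/2, v)`
with `v = ‖a - b‖² / σ²`. In an adaptive composition each round adds such an increment, with `v ≤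
1/σ²` depending on the history. By Jensen, the hockey-stick divergence `E (e^L - e^ε)₊` only grows
when each `v` is replaced by `1/σ²`; the increments then convolve to variance `T/σ²`
(`transcript_domination`, `isDP_of_callPrice_le`).

A Chernoff bound that keeps the prefactor (`callPrice_le`) gives at most `exp(-ε²u/2 + ε/2 -
1)/(εu)` with `u = σ²/T`. At `u ≈ 2L/ε²`, `L = log(1/δ)`, the factor `e⁻¹/(εu)` is worth `log(2L) +
1 - log ε` in the exponent, which is the gain in `V`; `exp_div_le_exp_neg` controls the
approximation.

For the moments accountant, `γ(α) = α/(2σ²)` and the infimum over `α` is explicit by AM-GM. Solving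
for `σ²` gives an exact threshold without that gain, so the difference of the two variances tends to
infinity. -/

namespace GaussDP

open scoped RealInnerProductSpace NNReal

/-! ### Isotropic Gaussians and their likelihood ratios. -/

variable {n : ℕ}

/-- The isotropic Gaussian measure `N(b, σ² Iₙ)`. -/
noncomputable def isoGaussian (b : EuclideanSpace ℝ (Fin n)) (σ : ℝ) :
    Measure (EuclideanSpace ℝ (Fin n)) :=
  multivariateGaussian b (σ ^ 2 • (1 : Matrix (Fin n) (Fin n) ℝ))

instance (b : EuclideanSpace ℝ (Fin n)) (σ : ℝ) : IsProbabilityMeasure (isoGaussian b σ) := by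
  unfold isoGaussian; infer_instance

lemma posSemidef_sq_smul_one (σ : ℝ) :
    (σ ^ 2 • (1 : Matrix (Fin n) (Fin n) ℝ)).PosSemidef :=
  Matrix.PosSemidef.one.smul (sq_nonneg σ)

lemma isoGaussian_map_inner (b t : EuclideanSpace ℝ (Fin n)) (σ : ℝ) :
    (isoGaussian b σ).map (fun y => ⟪t, y⟫) =
      gaussianReal ⟪t, b⟫ (σ ^ 2 * ‖t‖ ^ 2).toNNReal := by
  apply Measure.ext_of_charFun
  ext s
  rw [charFun_gaussianReal, charFun_apply,
    integral_map (by fun_prop) (by fun_prop)]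
  have h := charFun_multivariateGaussian (μ := b) (posSemidef_sq_smul_one (n := n) σ) (s • t)
  rw [charFun_apply] at h
  have e1 : ∀ x : EuclideanSpace ℝ (Fin n), ⟪x, s • t⟫ = ⟪(⟪t, x⟫ : ℝ), s⟫ := by
    intro x
    rw [inner_smul_right, real_inner_comm]
    simp
  simp_rw [e1] at h
  rw [isoGaussian, h, Real.coe_toNNReal _ (by positivity)]
  have e2 : (s • t).ofLp ⬝ᵥ (σ ^ 2 • (1 : Matrix (Fin n) (Fin n) ℝ)).mulVec (s • t).ofLp =
      σ ^ 2 * ‖t‖ ^ 2 * s ^ 2 := by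
    rw [Matrix.smul_mulVec, Matrix.one_mulVec, dotProduct_smul, EuclideanSpace.real_norm_sq_eq]
    simp [dotProduct, Finset.mul_sum, Finset.sum_mul]
    exact Finset.sum_congr rfl fun i _ => by ring
  rw [e2, real_inner_smul_left]
  push_cast
  ring_nf

lemma integrable_exp_inner_isoGaussian (b t : EuclideanSpace ℝ (Fin n)) (σ : ℝ) :
    Integrable (fun y => Real.exp ⟪t, y⟫) (isoGaussian b σ) := by
  have h := integrable_exp_mul_gaussianReal (μ := ⟪t, b⟫)
    (v := (σ ^ 2 * ‖t‖ ^ 2).toNNReal) 1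
  rw [← isoGaussian_map_inner, integrable_map_measure (by fun_prop) (by fun_prop)] at h
  simpa [Function.comp_def] using h

lemma integral_exp_inner_isoGaussian (b t : EuclideanSpace ℝ (Fin n)) (σ : ℝ) :
    ∫ y, Real.exp ⟪t, y⟫ ∂(isoGaussian b σ) =
      Real.exp (⟪t, b⟫ + σ ^ 2 * ‖t‖ ^ 2 / 2) := by
  have h := mgf_gaussianReal (isoGaussian_map_inner b t σ) 1
  rw [Real.coe_toNNReal _ (by positivity)] at h
  simpa [mgf] using h

/-- The logarithm of the likelihood ratio of `N(a, σ² Iₙ)` and `N(b, σ² Iₙ)`. -/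
noncomputable def logLik (σ : ℝ) (a b y : EuclideanSpace ℝ (Fin n)) : ℝ :=
  ⟪(σ ^ 2)⁻¹ • (a - b), y - b⟫ - ‖a - b‖ ^ 2 / (2 * σ ^ 2)

lemma isoGaussian_map_logLik (a b : EuclideanSpace ℝ (Fin n)) {σ : ℝ} (hσ : 0 < σ) :
    (isoGaussian b σ).map (logLik σ a b) =
      gaussianReal (-(‖a - b‖ ^ 2 / σ ^ 2).toNNReal / 2) (‖a - b‖ ^ 2 / σ ^ 2).toNNReal := by
  have h : logLik σ a b = (fun z => z + (-⟪(σ ^ 2)⁻¹ • (a - b), b⟫ -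
      ‖a - b‖ ^ 2 / (2 * σ ^ 2))) ∘ (fun y => ⟪(σ ^ 2)⁻¹ • (a - b), y⟫) := by
    ext y
    simp only [logLik, Function.comp, inner_sub_right]
    ring
  rw [h, ← Measure.map_map (by fun_prop) (by fun_prop), isoGaussian_map_inner,
    gaussianReal_map_add_const, Real.coe_toNNReal _ (by positivity)]
  have e : σ ^ 2 * ‖(σ ^ 2)⁻¹ • (a - b)‖ ^ 2 = ‖a - b‖ ^ 2 / σ ^ 2 := by
    rw [norm_smul, Real.norm_of_nonneg (by positivity)]
    field_simp
  rw [e]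
  congr 1
  field_simp
  ring

lemma integrable_exp_mul_logLik (a b : EuclideanSpace ℝ (Fin n)) {σ : ℝ} (hσ : 0 < σ) (c : ℝ) :
    Integrable (fun y => Real.exp (c * logLik σ a b y)) (isoGaussian b σ) := by
  have hm : Measurable (logLik σ a b) := by unfold logLik; fun_prop
  have h := integrable_exp_mul_gaussianReal (μ := -(‖a - b‖ ^ 2 / σ ^ 2).toNNReal / 2)
    (v := (‖a - b‖ ^ 2 / σ ^ 2).toNNReal) c
  rw [← isoGaussian_map_logLik a b hσ, integrable_map_measure (by fun_prop) (by fun_prop)] at h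
  exact h

lemma integral_exp_mul_logLik (a b : EuclideanSpace ℝ (Fin n)) {σ : ℝ} (hσ : 0 < σ) (c : ℝ) :
    ∫ y, Real.exp (c * logLik σ a b y) ∂(isoGaussian b σ) =
      Real.exp (c * (c - 1) * (‖a - b‖ ^ 2 / (2 * σ ^ 2))) := by
  have h := mgf_gaussianReal (isoGaussian_map_logLik a b hσ) c
  rw [Real.coe_toNNReal _ (by positivity)] at h
  rw [mgf] at h
  rw [h]
  congr 1
  field_simp
  ring

lemma lintegral_exp_mul_logLik (a b : EuclideanSpace ℝ (Fin n)) {σ : ℝ} (hσ : 0 < σ) (c : ℝ) :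
    ∫⁻ y, ENNReal.ofReal (Real.exp (c * logLik σ a b y)) ∂(isoGaussian b σ) =
      ENNReal.ofReal (Real.exp (c * (c - 1) * (‖a - b‖ ^ 2 / (2 * σ ^ 2)))) := by
  rw [← integral_exp_mul_logLik a b hσ c,
    ofReal_integral_eq_lintegral_ofReal (integrable_exp_mul_logLik a b hσ c)
      (ae_of_all _ fun _ => (Real.exp_pos _).le)]

/-- The moment generating functions of all linear functionals agree by completing the square. They
are finite on all of `ℝ`, so analytic continuation to `i` identifies the characteristic functions.
-/
lemma isoGaussian_eq_withDensity (a b : EuclideanSpace ℝ (Fin n)) {σ : ℝ} (hσ : 0 < σ) :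
    isoGaussian a σ =
      (isoGaussian b σ).withDensity (fun y => ENNReal.ofReal (Real.exp (logLik σ a b y))) := by
  have hm : Measurable (logLik σ a b) := by unfold logLik; fun_prop
  have : IsProbabilityMeasure ((isoGaussian b σ).withDensity
      (fun y => ENNReal.ofReal (Real.exp (logLik σ a b y)))) := by
    constructor
    rw [withDensity_apply _ .univ, Measure.restrict_univ]
    simpa using lintegral_exp_mul_logLik a b hσ 1
  apply Measure.ext_of_charFun
  ext t
  have key : mgf (fun y => ⟪t, y⟫) (isoGaussian a σ) = mgf (fun y => ⟪t, y⟫)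
      ((isoGaussian b σ).withDensity
        (fun y => ENNReal.ofReal (Real.exp (logLik σ a b y)))) := by
    ext s
    rw [mgf_gaussianReal (isoGaussian_map_inner a t σ), mgf,
      integral_withDensity_eq_integral_toReal_smul (by fun_prop) (by simp)]
    have e : ∀ y, (ENNReal.ofReal (Real.exp (logLik σ a b y))).toReal • Real.exp (s * ⟪t, y⟫) =
        Real.exp (-⟪(σ ^ 2)⁻¹ • (a - b), b⟫ - ‖a - b‖ ^ 2 / (2 * σ ^ 2)) *
          Real.exp ⟪(σ ^ 2)⁻¹ • (a - b) + s • t, y⟫ := by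
      intro y
      rw [ENNReal.toReal_ofReal (Real.exp_pos _).le, smul_eq_mul, ← Real.exp_add, ← Real.exp_add,
        logLik, inner_add_left, real_inner_smul_left t, inner_sub_right]
      ring_nf
    simp_rw [e]
    rw [integral_const_mul, integral_exp_inner_isoGaussian, ← Real.exp_add,
      Real.coe_toNNReal _ (by positivity), norm_add_sq_real, inner_add_left, norm_smul, norm_smul,
      mul_pow, mul_pow, real_inner_smul_left t, real_inner_smul_left, inner_smul_right,
      real_inner_comm t, inner_smul_right t, inner_sub_right t]
    simp only [Real.norm_eq_abs, sq_abs]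
    congr 1
    field_simp
    ring
  have h := eqOn_complexMGF_of_mgf key
  have h2 : integrableExpSet (fun y => ⟪t, y⟫) (isoGaussian a σ) = Set.univ := by
    ext s
    have := integrable_exp_inner_isoGaussian a (s • t) σ
    simpa [integrableExpSet, real_inner_smul_left] using this
  have h3 := h (x := Complex.I) (by simp [h2])
  simp only [complexMGF] at h3
  rw [charFun_apply, charFun_apply]
  simpa [mul_comm, real_inner_comm t] using h3

/-! ### Hockey-stick divergence of Gaussian pairs. -/

/-- The expected excess `E (x e^Z - γ)₊` for `Z ∼ N(-v/2, v)`: the hockey-stick divergence of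
order `γ` of a pair of Gaussians at squared distance `v`, when the likelihood ratio starts from
`x`. -/
noncomputable def callPrice (γ x : ℝ) (v : ℝ≥0) : ℝ≥0∞ :=
  ∫⁻ z, ENNReal.ofReal (x * Real.exp z - γ) ∂(gaussianReal (-v / 2) v)

lemma callPrice_zero (γ x : ℝ) : callPrice γ x 0 = ENNReal.ofReal (x - γ) := by
  simp [callPrice]

@[fun_prop]
lemma measurable_callPrice (γ : ℝ) (v : ℝ≥0) : Measurable (fun x => callPrice γ x v) := by
  unfold callPrice
  exact Measurable.lintegral_prod_right' (f := fun p : ℝ × ℝ =>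
    ENNReal.ofReal (p.1 * Real.exp p.2 - γ)) (by fun_prop)

/-- Semigroup property: the laws `N(-v/2, v)` convolve additively in `v`. -/
lemma lintegral_callPrice_mul_exp (γ x : ℝ) (v w : ℝ≥0) :
    ∫⁻ z, callPrice γ (x * Real.exp z) v ∂(gaussianReal (-w / 2) w) = callPrice γ x (v + w) := by
  have h : gaussianReal (-((v + w : ℝ≥0) : ℝ) / 2) (v + w) =
      Measure.conv (gaussianReal (-w / 2) w) (gaussianReal (-v / 2) v) := by
    rw [gaussianReal_conv_gaussianReal, add_comm v w]
    congr 1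
    push_cast
    ring
  rw [callPrice, h, Measure.lintegral_conv (by fun_prop)]
  simp_rw [callPrice, Real.exp_add, mul_assoc]

/-- Jensen for the positive part: `e^Z` has mean one under `N(-u/2, u)`, so an extra independent
increment can only raise the expected excess. -/
lemma callPrice_mono (γ x : ℝ) {v w : ℝ≥0} (hvw : v ≤ w) : callPrice γ x v ≤ callPrice γ x w := by
  obtain ⟨u, rfl⟩ := exists_add_of_le hvw
  rw [add_comm v u, ← lintegral_callPrice_mul_exp, callPrice]
  refine lintegral_mono fun z => ?_
  have hi : Integrable (fun y => x * Real.exp z * Real.exp y) (gaussianReal (-u / 2) u) := by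
    simpa using (integrable_exp_mul_gaussianReal (μ := -(u : ℝ) / 2) (v := u) 1).const_mul
      (x * Real.exp z)
  have h1 : ∫ y, Real.exp y ∂(gaussianReal (-u / 2) u) = 1 := by
    have h := congrFun (mgf_id_gaussianReal (μ := -(u : ℝ) / 2) (v := u)) 1
    simp only [mgf, id, one_mul] at h
    rw [h]
    ring_nf
    exact Real.exp_zero
  have h2 : x * Real.exp z - γ =
      ∫ y, (x * Real.exp z * Real.exp y - γ) ∂(gaussianReal (-u / 2) u) := by
    rw [integral_sub hi (integrable_const _), integral_const_mul, h1]
    simp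
  rw [h2, callPrice]
  have hi2 : Integrable (fun y => x * Real.exp z * Real.exp y - γ) (gaussianReal (-u / 2) u) :=
    hi.sub (integrable_const γ)
  have h3 : ∫ y, (x * Real.exp z * Real.exp y - γ) ∂(gaussianReal (-u / 2) u) ≤
      ∫ y, max (x * Real.exp z * Real.exp y - γ) 0 ∂(gaussianReal (-u / 2) u) :=
    integral_mono hi2 hi2.pos_part fun y => le_max_left _ _
  refine (ENNReal.ofReal_le_ofReal h3).trans_eq ?_
  rw [ofReal_integral_eq_lintegral_ofReal hi2.pos_part (ae_of_all _ fun _ => le_max_right _ _)]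
  exact lintegral_congr fun y => by simp [ENNReal.ofReal, Real.toNNReal]

/-- A Chernoff bound for the call price. -/
lemma callPrice_le {ε u : ℝ} (hε : 0 < ε) (hu : 0 < u) :
    callPrice (Real.exp ε) 1 (u⁻¹).toNNReal ≤
      ENNReal.ofReal (Real.exp (-(ε ^ 2 * u / 2) + ε / 2 - 1) / (ε * u)) := by
  set v := (u⁻¹).toNNReal with hv
  have hvu : (v : ℝ) = u⁻¹ := Real.coe_toNNReal _ (by positivity)
  -- Uses `1 - e⁻ʷ ≤ w ≤ e^(kw - 1)/k` with `w = z - ε` and `k = εu`. This `k` minimises the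
  -- Gaussian exponent up to lower order terms; the factor `e⁻¹/k` is the gain over the moments
  -- accountant.
  have hpt : ∀ z : ℝ, 1 * Real.exp z - Real.exp ε ≤
      Real.exp (-(ε * (ε * u)) - 1) / (ε * u) * Real.exp ((ε * u + 1) * z) := by
    intro z
    have hk : 0 < ε * u := by positivity
    have h1 : 1 - Real.exp (-(z - ε)) ≤ z - ε := by
      linarith [Real.add_one_le_exp (-(z - ε))]
    have h2 : z - ε ≤ Real.exp (ε * u * (z - ε) - 1) / (ε * u) := by
      rw [le_div_iff₀ hk]
      linarith [Real.add_one_le_exp (ε * u * (z - ε) - 1)]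
    have h3 := mul_le_mul_of_nonneg_left (h1.trans h2) (Real.exp_pos z).le
    calc 1 * Real.exp z - Real.exp ε = Real.exp z * (1 - Real.exp (-(z - ε))) := by
          rw [mul_sub, ← Real.exp_add]; ring_nf
      _ ≤ _ := h3
      _ = _ := by
          rw [mul_div_assoc', ← Real.exp_add, div_mul_eq_mul_div, ← Real.exp_add]
          ring_nf
  have hi : Integrable (fun z => Real.exp (-(ε * (ε * u)) - 1) / (ε * u) *
      Real.exp ((ε * u + 1) * z)) (gaussianReal (-v / 2) v) :=
    (integrable_exp_mul_gaussianReal _).const_mul _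
  calc callPrice (Real.exp ε) 1 v
      ≤ ∫⁻ z, ENNReal.ofReal (Real.exp (-(ε * (ε * u)) - 1) / (ε * u) *
          Real.exp ((ε * u + 1) * z)) ∂(gaussianReal (-v / 2) v) :=
        lintegral_mono fun z => ENNReal.ofReal_le_ofReal (hpt z)
    _ = ENNReal.ofReal (∫ z, Real.exp (-(ε * (ε * u)) - 1) / (ε * u) *
          Real.exp ((ε * u + 1) * z) ∂(gaussianReal (-v / 2) v)) :=
        (ofReal_integral_eq_lintegral_ofReal hi (ae_of_all _ fun _ => by positivity)).symm
    _ = _ := by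
        have h := congrFun (mgf_id_gaussianReal (μ := -(v : ℝ) / 2) (v := v)) (ε * u + 1)
        simp only [mgf, id] at h
        rw [integral_const_mul, h, hvu, div_mul_eq_mul_div, ← Real.exp_add]
        congr 3
        field_simp
        ring

/-! ### Adaptive transcripts. -/

variable {Y : Type v} [MeasurableSpace Y]

lemma measurable_snoc (T : ℕ) :
    Measurable (fun p : (Fin T → Y) × Y => (Fin.snoc p.1 p.2 : Fin (T + 1) → Y)) := by
  refine measurable_pi_lambda _ fun i => ?_
  refine Fin.lastCases ?_ (fun j => ?_) i
  · simpa using measurable_snd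
  · simpa using (by fun_prop : Measurable fun p : (Fin T → Y) × Y => p.1 j)

lemma transcript_isProbabilityMeasure (κ : ∀ i : ℕ, Kernel (Fin i → Y) Y) (T : ℕ)
    (h : ∀ i < T, IsMarkovKernel (κ i)) : IsProbabilityMeasure (transcript κ T) := by
  induction T with
  | zero => rw [transcript]; infer_instance
  | succ T ih =>
    have := ih fun i hi => h i (hi.trans T.lt_succ_self)
    have := h T T.lt_succ_self
    rw [transcript]
    exact Measure.isProbabilityMeasure_map (measurable_snoc T).aemeasurable

/-- If every round's log-likelihood ratio is Gaussian with variance at most `V`, then the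
log-likelihood ratio `L` of the transcript is dominated by a Gaussian of variance `T V`. -/
lemma transcript_domination (γ : ℝ) (V : ℝ≥0) (κ κ' : ∀ i : ℕ, Kernel (Fin i → Y) Y)
    (l : ∀ i : ℕ, (Fin i → Y) × Y → ℝ) (T : ℕ)
    (hκ : ∀ i < T, IsMarkovKernel (κ i)) (hκ' : ∀ i < T, IsMarkovKernel (κ' i))
    (hl : ∀ i < T, Measurable (l i))
    (hdens : ∀ i < T, ∀ h, κ i h =
      (κ' i h).withDensity (fun y => ENNReal.ofReal (Real.exp (l i (h, y)))))
    (hlaw : ∀ i < T, ∀ h, ∃ v ≤ V,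
      (κ' i h).map (fun y => l i (h, y)) = gaussianReal (-v / 2) v) :
    ∃ L : (Fin T → Y) → ℝ, Measurable L ∧
      transcript κ T = (transcript κ' T).withDensity (fun y => ENNReal.ofReal (Real.exp (L y))) ∧
      ∀ s, ∫⁻ y, callPrice γ (Real.exp (L y)) s ∂(transcript κ' T) ≤
        callPrice γ 1 (s + T * V) := by
  -- The spare variance `s` stays universally quantified: the last round, of variance at most `V`,
  -- is absorbed by applying the induction hypothesis at `s + V`.
  induction T with
  | zero => exact ⟨fun _ => 0, measurable_const, by simp [transcript], fun s => by simp [transcript]⟩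
  | succ T ih =>
    obtain ⟨L, hL, hd, hs⟩ := ih (fun i hi => hκ i (hi.trans T.lt_succ_self))
      (fun i hi => hκ' i (hi.trans T.lt_succ_self)) (fun i hi => hl i (hi.trans T.lt_succ_self))
      (fun i hi => hdens i (hi.trans T.lt_succ_self))
      (fun i hi => hlaw i (hi.trans T.lt_succ_self))
    have hT := T.lt_succ_self
    have := hκ T hT
    have := hκ' T hT
    have := transcript_isProbabilityMeasure κ T fun i hi => hκ i (hi.trans hT)
    have := transcript_isProbabilityMeasure κ' T fun i hi => hκ' i (hi.trans hT)
    have hlm := hl T hT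
    have hsn := measurable_snoc (Y := Y) T
    let L' : (Fin (T + 1) → Y) → ℝ := fun y => L (Fin.init y) + l T (Fin.init y, y (Fin.last T))
    have hinit : Measurable (fun y : Fin (T + 1) → Y => (Fin.init y : Fin T → Y)) :=
      measurable_pi_lambda _ fun i => measurable_pi_apply _
    have hL' : Measurable L' :=
      (hL.comp hinit).add (hlm.comp (hinit.prodMk (measurable_pi_apply _)))
    have hL's : ∀ p : (Fin T → Y) × Y,
        L' (Fin.snoc p.1 p.2 : Fin (T + 1) → Y) = L p.1 + l T p := by
      intro p
      simp [L', Fin.init_snoc]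
    refine ⟨L', hL', ?_, fun s => ?_⟩
    · refine Measure.ext_of_lintegral _ fun f hf => ?_
      have hf2 : Measurable (fun p : (Fin T → Y) × Y => f (Fin.snoc p.1 p.2 : Fin (T + 1) → Y)) :=
        hf.comp hsn
      rw [lintegral_withDensity_eq_lintegral_mul _ (by fun_prop) hf, transcript, transcript,
        lintegral_map hf hsn, lintegral_map (by fun_prop) hsn, Measure.lintegral_compProd hf2,
        Measure.lintegral_compProd (by fun_prop), hd,
        lintegral_withDensity_eq_lintegral_mul _ (by fun_prop) hf2.lintegral_kernel_prod_right']
      refine lintegral_congr fun h => ?_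
      have hf3 : Measurable (fun y : Y => f (Fin.snoc h y : Fin (T + 1) → Y)) :=
        hf2.comp measurable_prodMk_left
      have hl3 : Measurable (fun y : Y => l T (h, y)) := hlm.comp measurable_prodMk_left
      simp only [Pi.mul_apply]
      rw [hdens T hT h, lintegral_withDensity_eq_lintegral_mul _ (by fun_prop) hf3,
        ← lintegral_const_mul _ (by fun_prop)]
      refine lintegral_congr fun y => ?_
      rw [hL's (h, y), Real.exp_add, ENNReal.ofReal_mul (Real.exp_pos _).le]
      simp [mul_assoc]
    · have hc : Measurable (fun y => callPrice γ (Real.exp (L' y)) s) := by fun_prop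
      rw [transcript, lintegral_map hc hsn, Measure.lintegral_compProd (by fun_prop)]
      calc _ ≤ ∫⁻ h, callPrice γ (Real.exp (L h)) (s + V) ∂(transcript κ' T) := by
            refine lintegral_mono fun h => ?_
            obtain ⟨v, hv, hlv⟩ := hlaw T hT h
            have hl3 : Measurable (fun y : Y => l T (h, y)) := hlm.comp measurable_prodMk_left
            have he : ∀ y, L' (Fin.snoc h y : Fin (T + 1) → Y) = L h + l T (h, y) :=
              fun y => hL's (h, y)
            simp only [he, Real.exp_add]
            rw [← lintegral_map (μ := κ' T h)
              (f := fun z => callPrice γ (Real.exp (L h) * Real.exp z) s)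
              (g := fun y => l T (h, y)) (by fun_prop) hl3,
              hlv, lintegral_callPrice_mul_exp]
            exact callPrice_mono _ _ (by gcongr)
        _ ≤ _ := hs _
        _ = _ := by push_cast; ring_nf

/-- On `A`, `e^L ≤ γ + (e^L - γ)₊`; the integral of the excess is the case `s = 0` of the
domination. -/
lemma transcript_le (γ : ℝ) (V : ℝ≥0) (κ κ' : ∀ i : ℕ, Kernel (Fin i → Y) Y)
    (l : ∀ i : ℕ, (Fin i → Y) × Y → ℝ) (T : ℕ)
    (hκ : ∀ i < T, IsMarkovKernel (κ i)) (hκ' : ∀ i < T, IsMarkovKernel (κ' i))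
    (hl : ∀ i < T, Measurable (l i))
    (hdens : ∀ i < T, ∀ h, κ i h =
      (κ' i h).withDensity (fun y => ENNReal.ofReal (Real.exp (l i (h, y)))))
    (hlaw : ∀ i < T, ∀ h, ∃ v ≤ V,
      (κ' i h).map (fun y => l i (h, y)) = gaussianReal (-v / 2) v)
    {A : Set (Fin T → Y)} (hA : MeasurableSet A) :
    transcript κ T A ≤ ENNReal.ofReal γ * transcript κ' T A + callPrice γ 1 (T * V) := by
  obtain ⟨L, hL, hd, hs⟩ := transcript_domination γ V κ κ' l T hκ hκ' hl hdens hlaw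
  have h0 := hs 0
  simp only [callPrice_zero, zero_add] at h0
  rw [hd, withDensity_apply _ hA]
  calc ∫⁻ y in A, ENNReal.ofReal (Real.exp (L y)) ∂(transcript κ' T)
      ≤ ∫⁻ y in A, (ENNReal.ofReal γ + ENNReal.ofReal (Real.exp (L y) - γ)) ∂(transcript κ' T) := by
        refine lintegral_mono fun y => ?_
        simp only
        refine le_trans (le_of_eq ?_) ENNReal.ofReal_add_le
        ring_nf
    _ = ENNReal.ofReal γ * transcript κ' T A +
          ∫⁻ y in A, ENNReal.ofReal (Real.exp (L y) - γ) ∂(transcript κ' T) := by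
        rw [lintegral_add_left measurable_const, setLIntegral_const]
    _ ≤ _ := by
        gcongr
        exact (setLIntegral_le_lintegral _ _).trans h0

/-! ### Privacy of adaptive Gaussian composition. -/

lemma edist_le_l2Sensitivity {m n : ℕ} {X : Type u}
    (f : Dataset m X → EuclideanSpace ℝ (Fin n)) {d d' : Dataset m X} (h : Neighbor d d') :
    edist (f d) (f d') ≤ l2Sensitivity f :=
  le_iSup_of_le (f := fun d => ⨆ (d' : Dataset m X) (_ : Neighbor d d'), edist (f d) (f d')) d <|
    le_iSup₂_of_le (f := fun (d' : Dataset m X) (_ : Neighbor d d') => edist (f d) (f d')) d' h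
      le_rfl

/-- Adaptive composition of Gaussian mechanisms is no less private than one Gaussian mechanism
of sensitivity `√T`. -/
lemma isDP_of_callPrice_le {m n : ℕ} {X : Type u} {T : ℕ} {σ ε δ : ℝ} (hσ : 0 < σ)
    (κ : ∀ i : ℕ, Dataset m X →
      Kernel (Fin i → EuclideanSpace ℝ (Fin n)) (EuclideanSpace ℝ (Fin n)))
    (hκ : IsAdaptiveGaussian T σ κ)
    (hδ : callPrice (Real.exp ε) 1 (T / σ ^ 2).toNNReal ≤ ENNReal.ofReal δ) :
    IsDP (fun d => transcript (fun i => κ i d) T) ε δ := by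
  intro d d' hdd A hA
  -- The query is only given separately for each history, with no measurability in the history. The
  -- mean of the kernel recovers its value and is measurable.
  have hmean : ∀ i < T, ∀ h e, κ i e h = isoGaussian (∫ y, y ∂(κ i e h)) σ := by
    intro i hi h e
    obtain ⟨f, -, hf⟩ := hκ i hi h
    rw [hf e, gaussianMechanism, integral_id_multivariateGaussian]
    rfl
  have hmark : ∀ i < T, ∀ e, IsMarkovKernel (κ i e) := fun i hi e =>
    ⟨fun h => by rw [hmean i hi h e]; infer_instance⟩
  have hdist : ∀ i < T, ∀ h, ‖(∫ y, y ∂(κ i d h)) - ∫ y, y ∂(κ i d' h)‖ ≤ 1 := by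
    intro i hi h
    obtain ⟨f, hs, hf⟩ := hκ i hi h
    rw [hf d, hf d', gaussianMechanism, gaussianMechanism, integral_id_multivariateGaussian,
      integral_id_multivariateGaussian, ← dist_eq_norm]
    have h1 : edist (f d) (f d') ≤ 1 :=
      (edist_le_l2Sensitivity f hdd).trans hs
    rw [edist_dist] at h1
    simpa using h1
  have hmeas : ∀ i < T, ∀ e, Measurable (fun h => ∫ y, y ∂(κ i e h)) := by
    intro i hi e
    have := hmark i hi e
    exact (StronglyMeasurable.integral_kernel (κ := κ i e)
      (f := fun y => y) stronglyMeasurable_id).measurable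
  let l : ∀ i : ℕ, (Fin i → EuclideanSpace ℝ (Fin n)) × EuclideanSpace ℝ (Fin n) → ℝ := fun i p =>
    logLik σ (∫ y, y ∂(κ i d p.1)) (∫ y, y ∂(κ i d' p.1)) p.2
  have hl : ∀ i < T, Measurable (l i) := by
    intro i hi
    have h1 : Measurable fun p : (Fin i → EuclideanSpace ℝ (Fin n)) × EuclideanSpace ℝ (Fin n) =>
        ∫ y, y ∂(κ i d p.1) := (hmeas i hi d).comp measurable_fst
    have h2 : Measurable fun p : (Fin i → EuclideanSpace ℝ (Fin n)) × EuclideanSpace ℝ (Fin n) =>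
        ∫ y, y ∂(κ i d' p.1) := (hmeas i hi d').comp measurable_fst
    simp only [l, logLik]
    fun_prop
  refine (transcript_le (Real.exp ε) (1 / σ ^ 2).toNNReal _ (fun i => κ i d') l T
    (fun i hi => hmark i hi d) (fun i hi => hmark i hi d') hl ?_ ?_ hA).trans ?_
  · intro i hi h
    have := isoGaussian_eq_withDensity (∫ y, y ∂(κ i d h)) (∫ y, y ∂(κ i d' h)) hσ
    rwa [← hmean i hi h d, ← hmean i hi h d'] at this
  · intro i hi h
    have := isoGaussian_map_logLik (∫ y, y ∂(κ i d h)) (∫ y, y ∂(κ i d' h)) hσ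
    rw [← hmean i hi h d'] at this
    refine ⟨_, ?_, this⟩
    refine Real.toNNReal_le_toNNReal ?_
    have := hdist i hi h
    gcongr
    exact pow_le_one₀ (norm_nonneg _) this
  · gcongr
    refine le_trans (le_of_eq ?_) hδ
    congr 1
    rw [← Real.toNNReal_natCast, ← Real.toNNReal_mul (by positivity)]
    congr 1
    ring

/-! ### The moments accountant for Gaussian mechanisms. -/

lemma renyiDiv_isoGaussian {n : ℕ} (a b : EuclideanSpace ℝ (Fin n)) {σ α : ℝ} (hσ : 0 < σ)
    (hα : 1 < α) :
    renyiDiv α (isoGaussian a σ) (isoGaussian b σ) =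
      ((α / (2 * σ ^ 2) * ‖a - b‖ ^ 2 : ℝ) : EReal) := by
  have hm : Measurable (fun y => ENNReal.ofReal (Real.exp (logLik σ a b y))) := by
    unfold logLik; fun_prop
  have hd := isoGaussian_eq_withDensity a b hσ
  have hac : isoGaussian a σ ≪ isoGaussian b σ := by
    rw [hd]; exact withDensity_absolutelyContinuous _ _
  have hrn := Measure.rnDeriv_withDensity (isoGaussian b σ) hm
  rw [← hd] at hrn
  have hint : ∫⁻ y, ((isoGaussian a σ).rnDeriv (isoGaussian b σ) y) ^ α ∂(isoGaussian b σ) =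
      ENNReal.ofReal (Real.exp (α * (α - 1) * (‖a - b‖ ^ 2 / (2 * σ ^ 2)))) := by
    rw [← lintegral_exp_mul_logLik a b hσ α]
    refine lintegral_congr_ae ?_
    filter_upwards [hrn] with y hy
    rw [hy, ENNReal.ofReal_rpow_of_pos (Real.exp_pos _), ← Real.exp_mul, mul_comm]
  rw [renyiDiv, if_pos hac, hint, ENNReal.log_ofReal_of_pos (Real.exp_pos _), Real.log_exp,
    ← EReal.coe_mul]
  congr 1
  have : α - 1 ≠ 0 := by linarith
  field_simp

lemma rdpParam_gaussianMechanism {m n : ℕ} {X : Type u}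
    (f : Dataset m X → EuclideanSpace ℝ (Fin n)) {σ α : ℝ} (hσ : 0 < σ) (hα : 1 < α)
    (hf : l2Sensitivity f = 1) :
    rdpParam (gaussianMechanism f σ) α = ((α / (2 * σ ^ 2) : ℝ) : EReal) := by
  have hc : 0 < α / (2 * σ ^ 2) := by positivity
  have hval : ∀ d d', renyiDiv α (gaussianMechanism f σ d) (gaussianMechanism f σ d') =
      ((α / (2 * σ ^ 2) * ‖f d - f d'‖ ^ 2 : ℝ) : EReal) :=
    fun d d' => renyiDiv_isoGaussian _ _ hσ hα
  simp only [rdpParam, hval]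
  refine le_antisymm (iSup_le fun d => iSup_le fun d' => iSup_le fun h => ?_) ?_
  · have h1 := (edist_le_l2Sensitivity f h).trans_eq hf
    rw [edist_dist, dist_eq_norm] at h1
    have h2 : ‖f d - f d'‖ ≤ 1 := ENNReal.ofReal_le_one.1 h1
    rw [EReal.coe_le_coe_iff]
    exact mul_le_of_le_one_right hc.le (pow_le_one₀ (norm_nonneg _) h2)
  -- The sensitivity need not be attained. If the supremum lay below some `q < α/(2σ²)`, all
  -- neighbouring distances would be at most a constant below one.
  · by_contra! hlt
    obtain ⟨q, hq1, hq2⟩ := EReal.lt_iff_exists_real_btwn.1 hlt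
    rw [EReal.coe_lt_coe_iff] at hq2
    have hρ : q / (α / (2 * σ ^ 2)) < 1 := (div_lt_one hc).2 hq2
    have hs : l2Sensitivity f ≤ ENNReal.ofReal √(q / (α / (2 * σ ^ 2))) := by
      refine iSup_le fun d => iSup_le fun d' => iSup_le fun h => ?_
      rw [edist_dist, dist_eq_norm]
      refine ENNReal.ofReal_le_ofReal (Real.le_sqrt_of_sq_le ?_)
      rw [le_div_iff₀' hc, ← EReal.coe_le_coe_iff]
      refine le_trans ?_ hq1.le
      exact le_iSup_of_le d (le_iSup_of_le d' (le_iSup_of_le h le_rfl))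
    rw [hf, ENNReal.one_le_ofReal, Real.one_le_sqrt] at hs
    linarith

/-- AM-GM for `(α - 1)x` and `L/(α - 1)`, with equality at `α = 1 + √L/√x`. -/
lemma iInf_rdp_le_iff {x L ε : ℝ} (hx : 0 < x) (hL : 0 < L) :
    (⨅ (α : ℝ) (_ : 1 < α), ((α * x + (α - 1)⁻¹ * L : ℝ) : EReal)) ≤ (ε : EReal) ↔
      x + 2 * (√x * √L) ≤ ε := by
  have hsx := Real.sq_sqrt hx.le
  have hsL := Real.sq_sqrt hL.le
  have hx' := Real.sqrt_pos.2 hx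
  have hL' := Real.sqrt_pos.2 hL
  constructor
  · intro h
    rw [← EReal.coe_le_coe_iff]
    refine le_trans (le_iInf fun α => le_iInf fun hα => ?_) h
    rw [EReal.coe_le_coe_iff]
    have hk : 0 < α - 1 := by linarith
    have : 0 ≤ ((α - 1) * √x - √L) ^ 2 / (α - 1) := by positivity
    have e : ((α - 1) * √x - √L) ^ 2 / (α - 1) =
        (α - 1) * x + (α - 1)⁻¹ * L - 2 * (√x * √L) := by
      field_simp
      rw [sub_sq, mul_pow, hsx, hsL]
      ring
    linarith
  · intro h
    refine (iInf₂_le (1 + √L / √x) (by linarith [div_pos hL' hx'])).trans ?_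
    rw [EReal.coe_le_coe_iff]
    refine le_trans (le_of_eq ?_) h
    have e1 : √L / √x * x = √x * √L := by
      field_simp
      rw [hsx]
    have e2 : (√L / √x)⁻¹ * L = √x * √L := by
      field_simp
      rw [hsL]
    rw [add_sub_cancel_left, add_mul, e1, e2]
    ring

/-- Adding `L` completes the square: `√x + √L ≤ √(ε + L)` with `x = T/(2σ²)`. Rationalising the
difference of roots gives `T(s + l)² ≤ 2σ²ε²`, and `(s + l)² = 4L + 2ε - (s - l)²`. -/
lemma add_sqrt_le_iff {T σ L ε : ℝ} (hT : 0 < T) (hσ : 0 < σ) (hL : 0 < L) (hε : 0 < ε) :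
    T / (2 * σ ^ 2) + 2 * (√(T / (2 * σ ^ 2)) * √L) ≤ ε ↔
      2 * T / ε ^ 2 * L + T / ε - T / (2 * ε ^ 2) * (√(ε + L) - √L) ^ 2 ≤ σ ^ 2 := by
  have hx : 0 < T / (2 * σ ^ 2) := by positivity
  have hsx := Real.sq_sqrt hx.le
  have hsL := Real.sq_sqrt hL.le
  have hs := Real.sq_sqrt (show 0 ≤ ε + L by positivity)
  have hx' := Real.sqrt_pos.2 hx
  have hL' := Real.sqrt_pos.2 hL
  have hlt : √L < √(ε + L) := Real.sqrt_lt_sqrt hL.le (by linarith)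
  set y := √(T / (2 * σ ^ 2))
  set l := √L
  set s := √(ε + L)
  have h1 : T / (2 * σ ^ 2) + 2 * (y * l) ≤ ε ↔ (y + l) ^ 2 ≤ s ^ 2 := by
    rw [hs, add_sq, hsx, hsL]
    constructor <;> intro h <;> linarith
  have h2 : (y + l) ^ 2 ≤ s ^ 2 ↔ y ^ 2 ≤ (s - l) ^ 2 := by
    rw [sq_le_sq₀ (by positivity) (by positivity), sq_le_sq₀ (by positivity) (by linarith),
      le_sub_iff_add_le]
  have hprod : (s - l) * (s + l) = ε := by nlinarith
  have hsl : 0 < s + l := by linarith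
  have h3 : y ^ 2 ≤ (s - l) ^ 2 ↔ T * (s + l) ^ 2 ≤ 2 * σ ^ 2 * ε ^ 2 := by
    rw [hsx, div_le_iff₀ (by positivity), ← hprod, mul_pow, ← mul_le_mul_iff_left₀ (pow_pos hsl 2)]
    ring_nf
  have e : 2 * T / ε ^ 2 * L + T / ε - T / (2 * ε ^ 2) * (s - l) ^ 2 =
      T * (s + l) ^ 2 / (2 * ε ^ 2) := by
    field_simp
    nlinarith
  rw [h1, h2, h3, e, div_le_iff₀ (by positivity)]
  ring_nf

lemma maEpsilon_gaussianMechanism_le_iff {m n T : ℕ} {X : Type u}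
    (f : Dataset m X → EuclideanSpace ℝ (Fin n)) {σ ε δ : ℝ} (hT : 1 ≤ T) (hσ : 0 < σ)
    (hε : 0 < ε) (hδ : 0 < δ) (hδ1 : δ < 1) (hf : l2Sensitivity f = 1) :
    maEpsilon (gaussianMechanism f σ) T δ ≤ (ε : EReal) ↔
      maVariance T ε δ - T / (2 * ε ^ 2) * (√(ε + Real.log δ⁻¹) - √(Real.log δ⁻¹)) ^ 2 ≤
        σ ^ 2 := by
  have hT' : (0 : ℝ) < T := by exact_mod_cast hT
  have hL : 0 < Real.log δ⁻¹ := Real.log_pos ((one_lt_inv₀ hδ).2 hδ1)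
  have h : maEpsilon (gaussianMechanism f σ) T δ = ⨅ (α : ℝ) (_ : 1 < α),
      ((α * (T / (2 * σ ^ 2)) + (α - 1)⁻¹ * Real.log δ⁻¹ : ℝ) : EReal) := by
    refine iInf_congr fun α => iInf_congr fun hα => ?_
    rw [rdpParam_gaussianMechanism f hσ hα hf, ← EReal.coe_mul, ← EReal.coe_sub, Real.log_inv]
    congr 1
    ring
  rw [h, iInf_rdp_le_iff (by positivity) hL, add_sqrt_le_iff hT' hσ hL hε, maVariance, one_div]

/-! ### Solving the Chernoff bound for the variance. -/

lemma isDP_of_exp_div_le {m n : ℕ} {X : Type u} {T : ℕ} {σ ε δ : ℝ} (hT : 1 ≤ T) (hσ : 0 < σ)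
    (hε : 0 < ε)
    (κ : ∀ i : ℕ, Dataset m X →
      Kernel (Fin i → EuclideanSpace ℝ (Fin n)) (EuclideanSpace ℝ (Fin n)))
    (hκ : IsAdaptiveGaussian T σ κ) {u : ℝ} (hu : 0 < u) (huσ : T * u ≤ σ ^ 2)
    (h : Real.exp (-(ε ^ 2 * u / 2) + ε / 2 - 1) / (ε * u) ≤ δ) :
    IsDP (fun d => transcript (fun i => κ i d) T) ε δ := by
  have hT' : (0 : ℝ) < T := by exact_mod_cast hT
  refine isDP_of_callPrice_le hσ κ hκ ((callPrice_mono _ _ (Real.toNNReal_le_toNNReal ?_)).trans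
    ((callPrice_le hε hu).trans (ENNReal.ofReal_le_ofReal h)))
  rw [div_le_iff₀ (by positivity), ← div_eq_inv_mul, le_div_iff₀ hu]
  exact huσ

/-- The Chernoff bound meets the level `e^{-L}` at the improved variance once the remainder
outweighs the lower order terms. -/
lemma exp_div_le_exp_neg {ε L b r : ℝ} (hε : 0 < ε) (hL : 0 < L)
    (hb : |Real.log (2 * L) + 1 - Real.log ε - ε / 2| ≤ b) (hbL : 2 * b ≤ L)
    (hr : 2 * b / L ≤ ε ^ 2 * r / 2) {u : ℝ}
    (hu : u = 2 / ε ^ 2 * (L + ε / 2 - (Real.log (2 * L) + 1 - Real.log ε)) + r) :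
    0 < u ∧ Real.exp (-(ε ^ 2 * u / 2) + ε / 2 - 1) / (ε * u) ≤ Real.exp (-L) := by
  have hb0 : 0 ≤ b := (abs_nonneg _).trans hb
  have hbb := (abs_le.1 hb).2
  have e1 : ε ^ 2 * u / 2 =
      L - (Real.log (2 * L) + 1 - Real.log ε - ε / 2) + ε ^ 2 * r / 2 := by
    rw [hu]; field_simp; ring
  have hr0 : 0 ≤ ε ^ 2 * r / 2 := le_trans (by positivity) hr
  have h2 : L - b ≤ ε ^ 2 * u / 2 := by linarith
  have hLb : 0 < L - b := by linarith
  have hu0 : 0 < u := by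
    by_contra! hneg
    nlinarith [sq_nonneg ε]
  refine ⟨hu0, ?_⟩
  have h3 : 1 - b / L ≤ ε ^ 2 * u / (2 * L) := by
    rw [le_div_iff₀ (by positivity)]
    have : (1 - b / L) * (2 * L) = 2 * (L - b) := by field_simp
    linarith
  have hbL' : b / L ≤ 1 / 2 := by
    rw [div_le_iff₀ hL]; linarith
  have hpos : 0 < 1 - b / L := by linarith
  -- Replacing `εu` by `2L/ε` in the prefactor costs at most `2b/L` in the exponent, which `r`
  -- repays; `2b ≤ L` gives `(1 - b/L)⁻¹ ≤ 1 + 2b/L`.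
  have h4 : -(2 * b / L) ≤ Real.log (ε ^ 2 * u / (2 * L)) := by
    refine le_trans ?_ ((Real.one_sub_inv_le_log_of_pos hpos).trans (Real.log_le_log hpos h3))
    have hx : 0 ≤ b / L := by positivity
    have : (1 - b / L)⁻¹ ≤ 1 + 2 * (b / L) := by
      rw [inv_le_iff_one_le_mul₀ hpos]
      nlinarith
    have e : 2 * b / L = 2 * (b / L) := by ring
    linarith
  have h5 : Real.log (ε ^ 2 * u / (2 * L)) =
      Real.log ε + Real.log (ε * u) - Real.log (2 * L) := by
    rw [Real.log_div (by positivity) (by positivity), ← Real.log_mul (by positivity)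
      (by positivity)]
    ring_nf
  rw [div_le_iff₀ (by positivity), ← Real.exp_log (show 0 < ε * u by positivity),
    ← Real.exp_add]
  exact Real.exp_le_exp.2 (by linarith)

lemma tendsto_log_inv_nhdsGT_zero :
    Tendsto (fun δ : ℝ => Real.log δ⁻¹) (𝓝[>] 0) atTop :=
  Real.tendsto_log_atTop.comp tendsto_inv_nhdsGT_zero

lemma tendsto_log_sq_div_atTop :
    Tendsto (fun L : ℝ => Real.log L ^ 2 / L) atTop (𝓝 0) :=
  (Real.isLittleO_pow_log_id_atTop (n := 2)).tendsto_div_nhds_zero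

/-- Supplies `b = (log L)²` for `exp_div_le_exp_neg`. Squaring absorbs the constants in `ε` and is
the source of the `log²` in `R`. -/
lemma eventually_abs_log_le_sq (ε : ℝ) :
    ∀ᶠ L : ℝ in atTop, 0 < L ∧
      |Real.log (2 * L) + 1 - Real.log ε - ε / 2| ≤ Real.log L ^ 2 ∧
      2 * Real.log L ^ 2 ≤ L := by
  set c := |Real.log 2 + 1 - Real.log ε - ε / 2| with hc
  filter_upwards [eventually_gt_atTop 0, Real.tendsto_log_atTop.eventually_ge_atTop (1 + c),
    tendsto_log_sq_div_atTop.eventually_le_const (show (0 : ℝ) < 1 / 2 by norm_num)]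
    with L hL hlog hsq
  have hc0 : 0 ≤ c := abs_nonneg _
  refine ⟨hL, ?_, ?_⟩
  · rw [Real.log_mul two_ne_zero hL.ne']
    calc |Real.log 2 + Real.log L + 1 - Real.log ε - ε / 2|
        = |Real.log L + (Real.log 2 + 1 - Real.log ε - ε / 2)| := by ring_nf
      _ ≤ |Real.log L| + c := abs_add_le _ _
      _ = Real.log L + c := by rw [abs_of_nonneg (by linarith)]
      _ ≤ Real.log L ^ 2 := by nlinarith
  · rw [div_le_iff₀ hL] at hsq
    linarith

end GaussDP

/-! ### Choice of remainders and conclusion. -/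

theorem mainTheorem8 (T : ℕ) (hT : 1 ≤ T) (ε : ℝ) (hε : 0 < ε) :
    ∃ R RMA : ℝ → ℝ,
      -- the remainder terms, which depend on `T`, `ε` and `δ` only
      R =O[𝓝[>] (0 : ℝ)] (fun δ => Real.log (Real.log δ⁻¹) ^ 2 / Real.log δ⁻¹) ∧
      RMA =O[𝓝[>] (0 : ℝ)] (fun δ => 1 / Real.log δ⁻¹) ∧
      -- the improved variance suffices for adaptive composition
      (∀ δ : ℝ, 0 < δ → δ < 1 → 2 * δ * Real.log (1 / δ) < ε →
        ∀ (m n : ℕ) (X : Type u) (σ : ℝ), 0 < σ →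
          GaussDP.improvedVariance T ε δ + R δ ≤ σ ^ 2 →
          ∀ κ : ∀ i : ℕ, GaussDP.Dataset m X →
            Kernel (Fin i → EuclideanSpace ℝ (Fin n)) (EuclideanSpace ℝ (Fin n)),
            GaussDP.IsAdaptiveGaussian T σ κ →
            GaussDP.IsDP (fun d => GaussDP.transcript (fun i => κ i d) T) ε δ) ∧
      -- the variance that the moments accountant requires
      (∀ δ : ℝ, 0 < δ → δ < 1 →
        ∀ (m n : ℕ) (X : Type u) (f : GaussDP.Dataset m X → EuclideanSpace ℝ (Fin n)) (σ : ℝ),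
          0 < σ → GaussDP.l2Sensitivity f = 1 →
          (GaussDP.maEpsilon (GaussDP.gaussianMechanism f σ) T δ ≤ (ε : EReal) ↔
            GaussDP.maVariance T ε δ + RMA δ ≤ σ ^ 2)) ∧
      -- the former is smaller than the latter for all small `δ`
      (∀ᶠ δ in 𝓝[>] (0 : ℝ),
        GaussDP.improvedVariance T ε δ + R δ < GaussDP.maVariance T ε δ + RMA δ) := by
  have hT' : (0 : ℝ) < T := by exact_mod_cast hT
  have hLtop := GaussDP.tendsto_log_inv_nhdsGT_zero
  obtain ⟨δ₀, hδ₀, hsmall⟩ := mem_nhdsGT_iff_exists_Ioo_subset.1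
    (hLtop.eventually (GaussDP.eventually_abs_log_le_sq ε))
  rw [Set.mem_Ioi] at hδ₀
  -- Below `δ₀` the asymptotic estimate applies. Above it, `R` makes the total variance `T
  -- e^(ε/2)/(εδ)`, where the prefactor of the Chernoff bound alone suffices; the behaviour as `δ →
  -- 0` is unaffected.
  let R : ℝ → ℝ := fun δ =>
    if δ < δ₀ then 4 * T / ε ^ 2 * (Real.log (Real.log δ⁻¹) ^ 2 / Real.log δ⁻¹)
    else T * (Real.exp (ε / 2) / (ε * δ)) - GaussDP.improvedVariance T ε δ
  let RMA : ℝ → ℝ := fun δ =>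
    -(T / (2 * ε ^ 2) * (√(ε + Real.log δ⁻¹) - √(Real.log δ⁻¹)) ^ 2)
  have hR : R =O[𝓝[>] (0 : ℝ)] (fun δ => Real.log (Real.log δ⁻¹) ^ 2 / Real.log δ⁻¹) := by
    refine ((isBigO_refl _ _).const_mul_left (4 * T / ε ^ 2)).congr' ?_ EventuallyEq.rfl
    filter_upwards [Ioo_mem_nhdsGT hδ₀] with δ hδ
    simp only [R, if_pos hδ.2]
  have hRMA : RMA =O[𝓝[>] (0 : ℝ)] (fun δ => 1 / Real.log δ⁻¹) := by
    refine IsBigO.of_bound T ?_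
    filter_upwards [hLtop.eventually_gt_atTop 0] with δ hL
    set L := Real.log δ⁻¹
    have hl := Real.sqrt_pos.2 hL
    have hlt : √L < √(ε + L) := Real.sqrt_lt_sqrt hL.le (by linarith)
    have hprod : (√(ε + L) - √L) * (√(ε + L) + √L) = ε := by
      nlinarith [Real.sq_sqrt hL.le, Real.sq_sqrt (show 0 ≤ ε + L by positivity)]
    -- Since `√(ε + L) - √L = ε/(√(ε + L) + √L)`, the squared difference is at most `ε²/L`.
    have h1 : (√(ε + L) - √L) ^ 2 * L ≤ ε ^ 2 := by
      have h2 : L ≤ (√(ε + L) + √L) ^ 2 := by nlinarith [Real.sq_sqrt hL.le]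
      calc _ ≤ (√(ε + L) - √L) ^ 2 * (√(ε + L) + √L) ^ 2 := by gcongr
        _ = ε ^ 2 := by rw [← mul_pow, hprod]
    simp only [RMA]
    rw [norm_neg, Real.norm_of_nonneg (by positivity), Real.norm_of_nonneg (by positivity),
      mul_one_div, div_mul_eq_mul_div, div_le_div_iff₀ (by positivity) hL]
    nlinarith [sq_nonneg ε]
  refine ⟨R, RMA, hR, hRMA, ?_, ?_, ?_⟩
  · intro δ hδ hδ1 _ m n X σ hσ hV κ hκ
    by_cases hlt : δ < δ₀
    · obtain ⟨hL, hb, hbL⟩ := hsmall ⟨hδ, hlt⟩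
      obtain ⟨hu, h⟩ := GaussDP.exp_div_le_exp_neg hε hL hb hbL
        (r := 4 / ε ^ 2 * (Real.log (Real.log δ⁻¹) ^ 2 / Real.log δ⁻¹))
        (le_of_eq (by field_simp; ring)) rfl
      rw [Real.log_inv, neg_neg, Real.exp_log hδ, ← Real.log_inv] at h
      refine GaussDP.isDP_of_exp_div_le hT hσ hε κ hκ hu (le_trans (le_of_eq ?_) hV) h
      simp only [R, if_pos hlt, GaussDP.improvedVariance, one_div]
      field_simp
    · have hu : 0 < Real.exp (ε / 2) / (ε * δ) := by positivity
      refine GaussDP.isDP_of_exp_div_le hT hσ hε κ hκ hu (le_trans (le_of_eq ?_) hV) ?_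
      · simp only [R, if_neg hlt]
        ring
      · rw [div_le_iff₀ (by positivity)]
        have e : δ * (ε * (Real.exp (ε / 2) / (ε * δ))) = Real.exp (ε / 2) := by field_simp
        rw [e, Real.exp_le_exp]
        have : 0 ≤ ε ^ 2 * (Real.exp (ε / 2) / (ε * δ)) / 2 := by positivity
        linarith
  · intro δ hδ hδ1 m n X f σ hσ hf
    exact GaussDP.maEpsilon_gaussianMechanism_le_iff f hT hσ hε hδ hδ1 hf
  · have hR0 : Tendsto R (𝓝[>] 0) (𝓝 0) :=
      hR.trans_tendsto (GaussDP.tendsto_log_sq_div_atTop.comp hLtop)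
    have hRMA0 : Tendsto RMA (𝓝[>] 0) (𝓝 0) :=
      hRMA.trans_tendsto (hLtop.inv_tendsto_atTop.congr fun _ => (one_div _).symm)
    have hlog : Tendsto (fun δ : ℝ => 2 * T / ε ^ 2 *
        (Real.log (2 * Real.log δ⁻¹) + (1 - Real.log ε))) (𝓝[>] 0) atTop :=
      (tendsto_atTop_add_const_right _ _
        (Real.tendsto_log_atTop.comp (hLtop.const_mul_atTop two_pos))).const_mul_atTop
          (by positivity)
    -- Eventually `R < 1` and `RMA > -1`, so a logarithmic gain above `2` decides the comparison.
    filter_upwards [hR0.eventually_lt_const one_pos,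
      hRMA0.eventually_const_lt (show (-1 : ℝ) < 0 by norm_num),
      hlog.eventually_gt_atTop 2] with δ h1 h2 h3
    simp only [GaussDP.improvedVariance, GaussDP.maVariance]
    rw [← add_sub_assoc] at h3
    linarith
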